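/- Consider algebras $\langle A,\wedge,\vee,{}',{}^{\sim},0,1\rangle$ of type $\langle 2,2,1,1,0,0\rangle$. Such an algebra is a *PBZ\*-lattice* if - $\langle A,\wedge,\vee,0,1\rangle$ is a bounded lattice, $'$ is an order-reversing involution, and $a\wedge a'\le b\vee b'$ for all $a,b\in A$ (so that the $^{\sim}$-free reduct is a pseudo-Kleene algebra); - for all $a,b\in A$: $a\wedge a^{\sim}=0$; $a\le a^{\sim\sim}$; $a\le b$ implies $b^{\sim}\le a^{\sim}$; and $a^{\sim\prime}=a^{\sim\sim}$; - $(a\wedge a')^{\sim}\le a^{\sim}\vee a'^{\sim}$ for all $a\in A$; - for all $a,b\in A$, if $a\le b$ and $a'\wedge b=0$, then $a=b$. An *antiortholattice* is a PBZ\*-lattice in which $\{a\in A: a\wedge a'=0\}=\{0,1\}$; let $\mathbb{AOL}$ be the class of all antiortholattices. Let $\mathbb{V}_3$ be the class of all algebras of the above type that satisfy every identity valid in all members of $\mathbb{AOL}$ together with the two identities $$\text{(DIST)}\quad x\wedge(y\vee z)\approx(x\wedge y)\vee(x\wedge z),\qquad \text{(SDM)}\quad (x\wedge y)^{\sim}\approx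 x^{\sim}\vee y^{\sim}.$$ Let $\mathbf{D}_5$ be the $5$-element chain with its order-reversing involution $'$, and with $0^{\sim}=1$ and $a^{\sim}=0$ for $a>0$. For an algebra $\mathbf{A}$, let $V(\mathbf{A})$ be the variety generated by $\mathbf{A}$, that is, the smallest class of algebras of this type that contains $\mathbf{A}$ and is closed under homomorphic images, subalgebras and direct products. **Corollary.** $\mathbb{V}_3=V(\mathbf{D}_5)$. -/

import Mathlib

universe u

namespace PBZ

/-- The operations of an algebra `⟨A, ⊓, ⊔, ′, ~, ⊥, ⊤⟩` of type `⟨2, 2, 1, 1, 0, 0⟩`: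
`kl a` is the Kleene complement `a′` and `br a` is the Brouwer complement `a~`.
No laws are imposed here; they are conditions on algebras, stated below. -/
class Ops (A : Type u) extends Min A, Max A, Bot A, Top A where
  /-- Kleene complement -/
  kl : A → A
  /-- Brouwer complement -/
  br : A → A

/-- The algebras of type `⟨2, 2, 1, 1, 0, 0⟩`, with universe in `Type u`. -/
structure Alg : Type (u + 1) where
  carrier : Type u
  [ops : Ops carrier]

instance : CoeSort Alg.{u} (Type u) := ⟨Alg.carrier⟩

instance (A : Alg.{u}) : Ops A := A.ops

open Ops

section Axioms

variable (A : Type u) [Ops A]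

/-- `⟨A, ⊓, ⊔⟩` is a lattice with bounds `⊥`, `⊤`. The order is `a ≤ b` iff `a ⊓ b = a`. -/
structure IsBoundedLattice : Prop where
  inf_comm : ∀ a b : A, a ⊓ b = b ⊓ a
  sup_comm : ∀ a b : A, a ⊔ b = b ⊔ a
  inf_assoc : ∀ a b c : A, (a ⊓ b) ⊓ c = a ⊓ (b ⊓ c)
  sup_assoc : ∀ a b c : A, (a ⊔ b) ⊔ c = a ⊔ (b ⊔ c)
  inf_sup_self : ∀ a b : A, a ⊓ (a ⊔ b) = a
  sup_inf_self : ∀ a b : A, a ⊔ (a ⊓ b) = a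
  bot_le : ∀ a : A, ⊥ ⊓ a = ⊥
  le_top : ∀ a : A, a ⊓ ⊤ = a

variable {A} in
/-- The lattice order. -/
def Le (a b : A) : Prop := a ⊓ b = a

/-- Bounded involution lattices: `′` is an order-reversing involution. -/
structure IsBoundedInvolutionLattice : Prop extends IsBoundedLattice A where
  kl_kl : ∀ a : A, kl (kl a) = a
  kl_anti : ∀ a b : A, Le a b → Le (kl b) (kl a)

/-- Pseudo-Kleene algebras. -/
structure IsPseudoKleene : Prop extends IsBoundedInvolutionLattice A where
  kleene : ∀ a b : A, Le (a ⊓ kl a) (b ⊔ kl b)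

/-- Brouwer–Zadeh lattices. -/
structure IsBZLattice : Prop extends IsPseudoKleene A where
  inf_br : ∀ a : A, a ⊓ br a = ⊥
  le_br_br : ∀ a : A, Le a (br (br a))
  br_anti : ∀ a b : A, Le a b → Le (br b) (br a)
  kl_br : ∀ a : A, kl (br a) = br (br a)

/-- PBZ*-lattices: paraorthomodular BZ-lattices that satisfy the condition `(*)`. -/
structure IsPBZStarLattice : Prop extends IsBZLattice A where
  star : ∀ a : A, Le (br (a ⊓ kl a)) (br a ⊔ br (kl a))
  paraorthomodular : ∀ a b : A, Le a b → kl a ⊓ b = ⊥ → a = b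

/-- The Kleene-sharp elements. -/
def kleeneSharp : Set A := {a | a ⊓ kl a = ⊥}

/-- Antiortholattices: PBZ*-lattices whose only Kleene-sharp elements are the bounds. -/
structure IsAntiortholattice : Prop extends IsPBZStarLattice A where
  kleeneSharp_eq : kleeneSharp A = {⊥, ⊤}

end Axioms

/-- The class of antiortholattices. -/
def AOL : Set Alg.{u} := {A | IsAntiortholattice A}

section Equations

/-- Terms of the signature in the variables `x₀, x₁, x₂, …`. -/
inductive Term : Type where
  | var : ℕ → Term
  | inf : Term → Term → Term
  | sup : Term → Term → Term
  | kl : Term → Term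
  | br : Term → Term
  | bot : Term
  | top : Term

/-- The value of a term under an assignment of the variables. -/
def Term.eval {A : Type u} [Ops A] (v : ℕ → A) : Term → A
  | .var n => v n
  | .inf s t => s.eval v ⊓ t.eval v
  | .sup s t => s.eval v ⊔ t.eval v
  | .kl t => Ops.kl (t.eval v)
  | .br t => Ops.br (t.eval v)
  | .bot => ⊥
  | .top => ⊤

/-- `A` satisfies the identity `e.1 ≈ e.2`. -/
def Satisfies (A : Alg.{u}) (e : Term × Term) : Prop :=
  ∀ v : ℕ → A, e.1.eval v = e.2.eval v

/-- The identities valid in every member of `K`. -/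
def Identities (K : Set Alg.{u}) : Set (Term × Term) := {e | ∀ A ∈ K, Satisfies A e}

/-- The algebras that satisfy every identity in `E`. -/
def Mod (E : Set (Term × Term)) : Set Alg.{u} := {A | ∀ e ∈ E, Satisfies A e}

/-- The distributive law `x ∧ (y ∨ z) ≈ (x ∧ y) ∨ (x ∧ z)`. -/
def DIST : Term × Term :=
  (.inf (.var 0) (.sup (.var 1) (.var 2)),
    .sup (.inf (.var 0) (.var 1)) (.inf (.var 0) (.var 2)))

/-- The strong De Morgan law `(x ∧ y)~ ≈ x~ ∨ y~`. -/
def SDM : Term × Term :=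
  (.br (.inf (.var 0) (.var 1)), .sup (.br (.var 0)) (.br (.var 1)))

end Equations

section Varieties

/-- Homomorphisms of algebras. -/
structure IsHom {A B : Type u} [Ops A] [Ops B] (f : A → B) : Prop where
  map_inf : ∀ a b, f (a ⊓ b) = f a ⊓ f b
  map_sup : ∀ a b, f (a ⊔ b) = f a ⊔ f b
  map_kl : ∀ a, f (kl a) = kl (f a)
  map_br : ∀ a, f (br a) = br (f a)
  map_bot : f ⊥ = ⊥
  map_top : f ⊤ = ⊤

/-- The direct product of a family of algebras, with pointwise operations. -/
def prod {I : Type u} (A : I → Alg.{u}) : Alg.{u} where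
  carrier := ∀ i, A i
  ops :=
    { min := fun a b i => a i ⊓ b i
      max := fun a b i => a i ⊔ b i
      bot := fun _ => ⊥
      top := fun _ => ⊤
      kl := fun a i => kl (a i)
      br := fun a i => br (a i) }

/-- A variety: a class of algebras closed under homomorphic images, subalgebras (up to
isomorphism, that is, algebras that embed in a member) and direct products. -/
structure IsVariety (K : Set Alg.{u}) : Prop where
  image : ∀ (A B : Alg.{u}) (f : A → B), IsHom f → Function.Surjective f → A ∈ K → B ∈ K
  sub : ∀ (A B : Alg.{u}) (f : A → B), IsHom f → Function.Injective f → B ∈ K → A ∈ K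
  prod : ∀ (I : Type u) (A : I → Alg.{u}), (∀ i, A i ∈ K) → PBZ.prod A ∈ K

/-- The variety generated by `K`: the smallest variety that includes `K`. -/
def V (K : Set Alg.{u}) : Set Alg.{u} := {A | ∀ W : Set Alg.{u}, IsVariety W → K ⊆ W → A ∈ W}

end Varieties

/-- The `n`-element chain `0 < 1 < ⋯ < n - 1` (`n ≥ 1`) with `i′ = n - 1 - i`, and with
`i~` the top if `i` is the bottom, and the bottom otherwise. -/
def D (n : ℕ) [NeZero n] : Alg.{u} where
  carrier := ULift.{u} (Fin n)
  ops :=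
    { min := fun a b => ⟨min a.down b.down⟩
      max := fun a b => ⟨max a.down b.down⟩
      bot := ⟨0⟩
      top := ⟨Fin.rev 0⟩
      kl := fun a => ⟨Fin.rev a.down⟩
      br := fun a => if a.down = 0 then ⟨Fin.rev 0⟩ else ⟨0⟩ }

end PBZ

/-!
The homomorphisms from an algebra `A` of `𝕍₃` into `D₅` separate the points of `A`, so `A` embeds in
a power of `D₅`.

By (DIST) and the identities of antiortholattices, `A` is a bounded distributive lattice with a
Kleene involution `′`, and (SDM) makes `~` the pseudocomplement (`isStoneKleene_of_mem`). If `a ≰ b`,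
some prime ideal contains `b` but not `a`. Its dual `{x | x′ ∉ J}` is again a prime ideal, and by the
Kleene condition the two are comparable; let `J` be the larger one, and let `M ⊇ J` be a maximal
ideal (`IsKleene.exists_isIdealPair`). With the duals of `J` and `M` this gives a chain
`M* ⊆ J* ⊆ J ⊆ M` of prime ideals, and counting those that omit `x` gives a map
`level : A → {0, …, 4}` which preserves the lattice operations and `′`. Maximality of `M` says that
`M*` is a minimal prime ideal, which is what preservation of the pseudocomplement requires
(`IsIdealPair.level_br`).

Conversely, `D₅` is an antiortholattice that satisfies (DIST) and (SDM), and the models of a set of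
identities form a variety.
-/

namespace PBZ

open Order

/-! ### Prime ideals of Kleene lattices -/

section Kleene

variable {A : Type u} [DistribLattice A]

/-- `k` is a Kleene involution: an involutive dual endomorphism with `x ∧ x′ ≤ y ∨ y′`. -/
structure IsKleene (k : A → A) : Prop where
  kl_kl : ∀ x, k (k x) = x
  kl_inf : ∀ x y, k (x ⊓ y) = k x ⊔ k y
  kleene : ∀ x y, x ⊓ k x ≤ y ⊔ k y

variable {k : A → A}

theorem IsKleene.kl_sup (h : IsKleene k) (x y : A) : k (x ⊔ y) = k x ⊓ k y := by
  rw [← h.kl_kl (k x ⊓ k y), h.kl_inf, h.kl_kl, h.kl_kl]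

theorem IsKleene.kl_anti (h : IsKleene k) {x y : A} (hxy : x ≤ y) : k y ≤ k x := by
  rw [← inf_eq_left.2 hxy, h.kl_inf]
  exact le_sup_right

theorem mem_ideal_inf_iff {I : Ideal A} (hI : I.IsPrime) {x y : A} :
    x ⊓ y ∈ I ↔ x ∈ I ∨ y ∈ I :=
  ⟨hI.mem_or_mem, fun h => h.elim (I.lower inf_le_left) (I.lower inf_le_right)⟩

/-- The dual `{x | x′ ∉ J}` of a prime ideal `J`. -/
def IsKleene.dualIdeal (h : IsKleene k) (J : Ideal A) (hJ : J.IsPrime) : Ideal A where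
  carrier := {x | k x ∉ J}
  lower' := fun _ _ hyx hx hy => hx (J.lower (h.kl_anti hyx) hy)
  nonempty' := by
    obtain ⟨w, hw⟩ : ∃ w, w ∉ J := by
      by_contra! hall
      exact hJ.toIsProper.ne_univ (Set.eq_univ_of_forall hall)
    exact ⟨k w, by rwa [Set.mem_ofPred_eq, h.kl_kl]⟩
  directed' := by
    intro x hx y hy
    refine ⟨x ⊔ y, ?_, le_sup_left, le_sup_right⟩
    change k (x ⊔ y) ∉ J
    rw [h.kl_sup]
    exact fun hxy => (hJ.mem_or_mem hxy).elim hx hy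

theorem IsKleene.mem_dualIdeal (h : IsKleene k) {J : Ideal A} (hJ : J.IsPrime) {x : A} :
    x ∈ h.dualIdeal J hJ ↔ k x ∉ J := Iff.rfl

theorem IsKleene.isPrime_dualIdeal (h : IsKleene k) {J : Ideal A} (hJ : J.IsPrime) :
    (h.dualIdeal J hJ).IsPrime := by
  obtain ⟨w, hw⟩ := J.nonempty
  have : (h.dualIdeal J hJ).IsProper := by
    refine Ideal.isProper_of_notMem (p := k w) ?_
    rw [h.mem_dualIdeal, h.kl_kl]
    exact not_not.2 hw
  refine Ideal.IsPrime.of_mem_or_mem fun {x y} hxy => ?_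
  rwa [h.mem_dualIdeal, h.kl_inf, Ideal.sup_mem_iff, not_and_or] at hxy

/-- A prime ideal `J` that includes its dual, and a maximal ideal `M` that includes `J`; that is, a
chain `M* ⊆ J* ⊆ J ⊆ M` where `I*` is the dual of `I` and `M` is maximal. -/
structure IsIdealPair (k : A → A) (J M : Ideal A) : Prop where
  isPrime : J.IsPrime
  isMaximal : M.IsMaximal
  le : J ≤ M
  mem_or_kl_mem : ∀ x, x ∈ J ∨ k x ∈ J

/-- Two elements `a ≰ b` are separated by the smaller ideal of some pair or by its dual. -/
theorem IsKleene.exists_isIdealPair [BoundedOrder A] (h : IsKleene k) {a b : A} (hab : ¬ a ≤ b) :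
    ∃ J M : Ideal A, IsIdealPair k J M ∧ ((a ∉ J ∧ b ∈ J) ∨ (k b ∉ J ∧ k a ∈ J)) := by
  have hdisj : Disjoint (PFilter.principal a : Set A) (Ideal.principal b : Set A) := by
    rw [Set.disjoint_left]
    intro x hx hx'
    exact hab (le_trans (PFilter.mem_principal.1 hx) (Ideal.mem_principal.1 hx'))
  obtain ⟨J, hJ, hbJ, haJ⟩ := DistribLattice.prime_ideal_of_disjoint_filter_ideal hdisj
  have hb : b ∈ J := hbJ (Ideal.mem_principal.2 le_rfl)
  have ha : a ∉ J := Set.disjoint_left.1 haJ (PFilter.mem_principal.2 le_rfl)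
  -- The Kleene condition makes a prime ideal and its dual comparable.
  have hcomp : (∀ x, x ∈ J ∨ k x ∈ J) ∨ (∀ x, ¬ (x ∈ J ∧ k x ∈ J)) := by
    by_contra! hne
    obtain ⟨⟨x, hx, hkx⟩, y, hy, hky⟩ := hne
    exact (hJ.mem_or_mem (J.lower (h.kleene x y) (Ideal.sup_mem hy hky))).elim hx hkx
  rcases hcomp with hJk | hJk
  · obtain ⟨M, hJM, hM⟩ := hJ.toIsProper.exists_le_maximal
    exact ⟨J, M, ⟨hJ, hM, hJM, hJk⟩, Or.inl ⟨ha, hb⟩⟩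
  · have hJ' := h.isPrime_dualIdeal hJ
    obtain ⟨M, hJM, hM⟩ := hJ'.toIsProper.exists_le_maximal
    refine ⟨h.dualIdeal J hJ, M, ⟨hJ', hM, hJM, fun x => ?_⟩, Or.inr ?_⟩
    · rw [h.mem_dualIdeal, h.mem_dualIdeal, h.kl_kl]
      exact not_and_or.1 fun hx => hJk x hx.symm
    · rw [h.mem_dualIdeal, h.mem_dualIdeal, h.kl_kl, h.kl_kl]
      exact ⟨not_not.2 hb, ha⟩

/-! ### The map to the five-element chain -/

open Classical in
/-- For an ideal pair `J`, `M`, the number of ideals in the chain `M* ⊆ J* ⊆ J ⊆ M` that do not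
contain `x`, where `I* = {x | k x ∉ I}`. -/
noncomputable def level (k : A → A) (J M : Ideal A) (x : A) : Fin 5 :=
  if x ∉ M then 4 else if x ∉ J then 3 else if k x ∈ J then 2 else if k x ∈ M then 1 else 0

variable {J M : Ideal A}

theorem IsIdealPair.mem_cases (p : IsIdealPair k J M) (x : A) :
    (x ∉ M ∧ x ∉ J ∧ k x ∈ J ∧ k x ∈ M) ∨ (x ∈ M ∧ x ∉ J ∧ k x ∈ J ∧ k x ∈ M) ∨
      (x ∈ M ∧ x ∈ J ∧ k x ∈ J ∧ k x ∈ M) ∨ (x ∈ M ∧ x ∈ J ∧ k x ∉ J ∧ k x ∈ M) ∨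
      (x ∈ M ∧ x ∈ J ∧ k x ∉ J ∧ k x ∉ M) := by
  have h1 := @p.le x
  have h2 := @p.le (k x)
  have h3 := p.mem_or_kl_mem x
  tauto

theorem IsIdealPair.isPrime_of_isMaximal (p : IsIdealPair k J M) : M.IsPrime := by
  have := p.isMaximal
  infer_instance

theorem IsIdealPair.level_inf (p : IsIdealPair k J M) (h : IsKleene k) (x y : A) :
    level k J M (x ⊓ y) = min (level k J M x) (level k J M y) := by
  classical
  simp only [level, h.kl_inf, mem_ideal_inf_iff p.isPrime,
    mem_ideal_inf_iff p.isPrime_of_isMaximal, Ideal.sup_mem_iff]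
  rcases p.mem_cases x with ⟨h1, h2, h3, h4⟩ | ⟨h1, h2, h3, h4⟩ | ⟨h1, h2, h3, h4⟩ |
    ⟨h1, h2, h3, h4⟩ | ⟨h1, h2, h3, h4⟩ <;>
  rcases p.mem_cases y with ⟨g1, g2, g3, g4⟩ | ⟨g1, g2, g3, g4⟩ | ⟨g1, g2, g3, g4⟩ |
    ⟨g1, g2, g3, g4⟩ | ⟨g1, g2, g3, g4⟩ <;>
  simp only [h1, h2, h3, h4, g1, g2, g3, g4, not_true, not_false_eq_true, if_true, if_false,
    and_self, and_true, or_self, or_true, or_false, and_false] <;>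
  decide

theorem IsIdealPair.level_kl (p : IsIdealPair k J M) (h : IsKleene k) (x : A) :
    level k J M (k x) = Fin.rev (level k J M x) := by
  classical
  simp only [level, h.kl_kl]
  rcases p.mem_cases x with ⟨h1, h2, h3, h4⟩ | ⟨h1, h2, h3, h4⟩ | ⟨h1, h2, h3, h4⟩ |
    ⟨h1, h2, h3, h4⟩ | ⟨h1, h2, h3, h4⟩ <;>
  simp only [h1, h2, h3, h4, not_true, not_false_eq_true, if_true, if_false] <;>
  decide

theorem IsIdealPair.level_sup (p : IsIdealPair k J M) (h : IsKleene k) (x y : A) :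
    level k J M (x ⊔ y) = max (level k J M x) (level k J M y) := by
  have key : ∀ i j : Fin 5, Fin.rev (min (Fin.rev i) (Fin.rev j)) = max i j := by decide
  rw [← h.kl_kl (x ⊔ y), h.kl_sup, p.level_kl h, p.level_inf h, p.level_kl h, p.level_kl h, key]

theorem IsIdealPair.level_eq_zero (p : IsIdealPair k J M) {x : A} :
    level k J M x = 0 ↔ k x ∉ M := by
  simp only [level]
  rcases p.mem_cases x with ⟨h1, h2, h3, h4⟩ | ⟨h1, h2, h3, h4⟩ | ⟨h1, h2, h3, h4⟩ |
    ⟨h1, h2, h3, h4⟩ | ⟨h1, h2, h3, h4⟩ <;>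
  simp only [h1, h2, h3, h4, not_true, not_false_eq_true, if_true, if_false] <;>
  decide

theorem level_eq_four {x : A} (hx : x ∉ M) : level k J M x = 4 := if_pos hx

theorem IsIdealPair.level_ne (p : IsIdealPair k J M) {x y : A} (hx : x ∉ J) (hy : y ∈ J) :
    level k J M x ≠ level k J M y := by
  simp only [level]
  rcases p.mem_cases x with ⟨h1, h2, h3, h4⟩ | ⟨h1, h2, h3, h4⟩ | ⟨h1, h2, h3, h4⟩ |
    ⟨h1, h2, h3, h4⟩ | ⟨h1, h2, h3, h4⟩ <;>
  simp only [hx] at h2 <;>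
  simp only [hx, hy, p.le hy, h1, not_true, not_false_eq_true, if_true, if_false] <;>
  split_ifs <;> decide

variable [BoundedOrder A]

theorem IsKleene.kl_top (h : IsKleene k) : k ⊤ = ⊥ :=
  le_bot_iff.1 <| (h.kl_anti le_top).trans_eq (h.kl_kl ⊥)

theorem IsKleene.kl_bot (h : IsKleene k) : k ⊥ = ⊤ := by
  rw [← h.kl_top, h.kl_kl]

/-- `k` is a Kleene involution and `br` is a pseudocomplementation whose values are
complemented by `k`. -/
structure IsStoneKleene (k br : A → A) : Prop extends IsKleene k where
  inf_br : ∀ x, x ⊓ br x = ⊥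
  le_br : ∀ x y, x ⊓ y = ⊥ → y ≤ br x
  kl_br : ∀ x, k (br x) = br (br x)

theorem IsStoneKleene.sup_kl_br {br : A → A} (h : IsStoneKleene k br) (x : A) :
    br x ⊔ k (br x) = ⊤ := by
  have := congrArg k (h.inf_br (br x))
  rwa [← h.kl_br, h.kl_inf, h.kl_kl, h.kl_bot, sup_comm] at this

/-- The dual of `M` is a minimal prime ideal, so it contains exactly one of `x` and its
pseudocomplement. -/
theorem IsIdealPair.level_br (p : IsIdealPair k J M) {br : A → A} (h : IsStoneKleene k br) (x : A) :
    level k J M (br x) = if level k J M x = 0 then 4 else 0 := by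
  have htop : ⊤ ∉ M := p.isMaximal.toIsProper.top_notMem
  split_ifs with hx
  · rw [p.level_eq_zero] at hx
    -- By maximality of `M` there is `y ∈ M` with `x′ ∨ y = ⊤`; then `x ∧ y′ = ⊥` and `y′ ≤ x~`.
    have hmem : (⊤ : A) ∈ (M ⊔ Ideal.principal (k x) : Ideal A) := by
      rw [← SetLike.mem_coe,
        p.isMaximal.maximal_proper (Ideal.lt_sup_principal_of_notMem hx)]
      trivial
    obtain ⟨y, hy, hle⟩ := (Lattice.mem_ideal_sup_principal _ _ _).1 hmem
    have hxy : x ⊓ k y = ⊥ := by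
      rw [← h.kl_top, ← top_le_iff.1 hle, h.kl_sup, h.kl_kl, inf_comm]
    have hbr : k (br x) ∈ M := by
      refine M.lower ?_ hy
      rw [← h.kl_kl y]
      exact h.kl_anti (h.le_br x (k y) hxy)
    refine level_eq_four fun hbx => htop ?_
    rw [← h.sup_kl_br x]
    exact Ideal.sup_mem hbx hbr
  · rw [p.level_eq_zero, not_not] at hx
    rw [p.level_eq_zero]
    intro hbx
    apply htop
    rw [← h.kl_bot, ← h.inf_br x, h.kl_inf]
    exact Ideal.sup_mem hx hbx

end Kleene

/-! ### Consequences of the identities -/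

section Identities

/-- The lattice whose operations are those of the signature. -/
abbrev IsBoundedLattice.toLattice {A : Type u} [Ops A] (h : IsBoundedLattice A) : Lattice A :=
  Lattice.mk' h.sup_comm h.sup_assoc h.inf_comm h.inf_assoc h.sup_inf_self h.inf_sup_self

theorem IsBoundedInvolutionLattice.kl_inf {A : Type u} [Ops A] (h : IsBoundedInvolutionLattice A)
    (a b : A) : Ops.kl (a ⊓ b) = Ops.kl a ⊔ Ops.kl b := by
  let := h.toIsBoundedLattice.toLattice
  have anti : ∀ x y : A, x ≤ y → Ops.kl y ≤ Ops.kl x := fun x y hxy =>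
    inf_eq_left.1 (h.kl_anti x y (inf_eq_left.2 hxy))
  apply le_antisymm
  · rw [← h.kl_kl (Ops.kl a ⊔ Ops.kl b)]
    refine anti _ _ (le_inf ?_ ?_)
    · exact (anti _ _ le_sup_left).trans_eq (h.kl_kl a)
    · exact (anti _ _ le_sup_right).trans_eq (h.kl_kl b)
  · exact sup_le (anti _ _ inf_le_left) (anti _ _ inf_le_right)

/-- The assignment `x₀ ↦ a`, `x₁ ↦ b`, `x_n ↦ c` for `n ≥ 2`. -/
def assign {A : Type u} (a b c : A) : ℕ → A
  | 0 => a
  | 1 => b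
  | _ => c

variable {A : Alg.{u}}

theorem eval_eq_of_mem (hA : A ∈ Mod (Identities AOL.{u} ∪ {DIST, SDM})) (s t : Term)
    (h : ∀ B ∈ AOL.{u}, Satisfies B (s, t)) (v : ℕ → A) : s.eval v = t.eval v :=
  hA (s, t) (Or.inl h) v

theorem isBoundedLattice_of_mem (hA : A ∈ Mod (Identities AOL.{u} ∪ {DIST, SDM})) :
    IsBoundedLattice A where
  inf_comm a b := eval_eq_of_mem hA (.inf (.var 0) (.var 1)) (.inf (.var 1) (.var 0))
    (fun _ hB v => hB.inf_comm (v 0) (v 1)) (assign a b b)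
  sup_comm a b := eval_eq_of_mem hA (.sup (.var 0) (.var 1)) (.sup (.var 1) (.var 0))
    (fun _ hB v => hB.sup_comm (v 0) (v 1)) (assign a b b)
  inf_assoc a b c := eval_eq_of_mem hA (.inf (.inf (.var 0) (.var 1)) (.var 2))
    (.inf (.var 0) (.inf (.var 1) (.var 2)))
    (fun _ hB v => hB.inf_assoc (v 0) (v 1) (v 2)) (assign a b c)
  sup_assoc a b c := eval_eq_of_mem hA (.sup (.sup (.var 0) (.var 1)) (.var 2))
    (.sup (.var 0) (.sup (.var 1) (.var 2)))
    (fun _ hB v => hB.sup_assoc (v 0) (v 1) (v 2)) (assign a b c)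
  inf_sup_self a b := eval_eq_of_mem hA (.inf (.var 0) (.sup (.var 0) (.var 1))) (.var 0)
    (fun _ hB v => hB.inf_sup_self (v 0) (v 1)) (assign a b b)
  sup_inf_self a b := eval_eq_of_mem hA (.sup (.var 0) (.inf (.var 0) (.var 1))) (.var 0)
    (fun _ hB v => hB.sup_inf_self (v 0) (v 1)) (assign a b b)
  bot_le a := eval_eq_of_mem hA (.inf .bot (.var 0)) .bot
    (fun _ hB v => hB.bot_le (v 0)) (assign a a a)
  le_top a := eval_eq_of_mem hA (.inf (.var 0) .top) (.var 0)
    (fun _ hB v => hB.le_top (v 0)) (assign a a a)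

/-- The distributive lattice underlying an algebra of `𝕍₃`. -/
abbrev distribLatticeOfMem (hA : A ∈ Mod (Identities AOL.{u} ∪ {DIST, SDM})) :
    DistribLattice A :=
  letI := (isBoundedLattice_of_mem hA).toLattice
  DistribLattice.ofInfSupLe fun a b c => le_of_eq (hA DIST (by simp) (assign a b c))

/-- The bounds of an algebra of `𝕍₃`. -/
abbrev boundedOrderOfMem (hA : A ∈ Mod (Identities AOL.{u} ∪ {DIST, SDM})) :
    letI := distribLatticeOfMem hA
    BoundedOrder A :=
  letI := distribLatticeOfMem hA
  { bot := ⊥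
    top := ⊤
    bot_le := fun a => inf_eq_left.1 ((isBoundedLattice_of_mem hA).bot_le a)
    le_top := fun a => inf_eq_left.1 ((isBoundedLattice_of_mem hA).le_top a) }

theorem isStoneKleene_of_mem (hA : A ∈ Mod (Identities AOL.{u} ∪ {DIST, SDM})) :
    letI := distribLatticeOfMem hA
    letI := boundedOrderOfMem hA
    IsStoneKleene (Ops.kl : A → A) Ops.br := by
  let := distribLatticeOfMem hA
  let := boundedOrderOfMem hA
  have inf_br : ∀ a : A, a ⊓ Ops.br a = ⊥ := fun a =>
    eval_eq_of_mem hA (.inf (.var 0) (.br (.var 0))) .bot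
      (fun _ hB v => hB.inf_br (v 0)) (assign a a a)
  have le_br_br : ∀ a : A, a ⊓ Ops.br (Ops.br a) = a := fun a =>
    eval_eq_of_mem hA (.inf (.var 0) (.br (.br (.var 0)))) (.var 0)
      (fun _ hB v => hB.le_br_br (v 0)) (assign a a a)
  have sdm : ∀ a b : A, Ops.br (a ⊓ b) = Ops.br a ⊔ Ops.br b := fun a b =>
    hA SDM (by simp) (assign a b b)
  have br_bot : Ops.br (⊥ : A) = ⊤ := by
    have h1 : Ops.br (⊤ : A) = ⊥ := by rw [← inf_br ⊤, top_inf_eq]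
    have h2 := le_br_br ⊤
    rwa [h1, top_inf_eq] at h2
  exact
    { kl_kl := fun a => eval_eq_of_mem hA (.kl (.kl (.var 0))) (.var 0)
        (fun _ hB v => hB.kl_kl (v 0)) (assign a a a)
      kl_inf := fun a b => eval_eq_of_mem hA (.kl (.inf (.var 0) (.var 1)))
        (.sup (.kl (.var 0)) (.kl (.var 1)))
        (fun _ hB v => hB.toIsBoundedInvolutionLattice.kl_inf (v 0) (v 1)) (assign a b b)
      kleene := fun a b => inf_eq_left.1 <| eval_eq_of_mem hA
        (.inf (.inf (.var 0) (.kl (.var 0))) (.sup (.var 1) (.kl (.var 1))))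
        (.inf (.var 0) (.kl (.var 0)))
        (fun _ hB v => hB.kleene (v 0) (v 1)) (assign a b b)
      inf_br := inf_br
      le_br := fun a b hab => by
        -- (SDM) turns `a ∧ b = ⊥` into `a~ ∨ b~ = ⊤`, and `b` is disjoint from `b~`.
        have htop : Ops.br a ⊔ Ops.br b = ⊤ := by rw [← sdm, hab, br_bot]
        calc b = b ⊓ (Ops.br a ⊔ Ops.br b) := by rw [htop, inf_top_eq]
          _ = b ⊓ Ops.br a := by rw [inf_sup_left, inf_br, sup_bot_eq]
          _ ≤ Ops.br a := inf_le_right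
      kl_br := fun a => eval_eq_of_mem hA (.kl (.br (.var 0))) (.br (.br (.var 0)))
        (fun _ hB v => hB.kl_br (v 0)) (assign a a a) }

theorem exists_isHom_ne (hA : A ∈ Mod (Identities AOL.{u} ∪ {DIST, SDM})) {a b : A}
    (hab : a ≠ b) : ∃ f : A → D.{u} 5, IsHom f ∧ f a ≠ f b := by
  let := distribLatticeOfMem hA
  let := boundedOrderOfMem hA
  have h := isStoneKleene_of_mem hA
  have main : ∀ a b : A, ¬ a ≤ b → ∃ f : A → D.{u} 5, IsHom f ∧ f a ≠ f b := by
    intro a b hab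
    obtain ⟨J, M, p, hsep⟩ := h.toIsKleene.exists_isIdealPair hab
    have hbot : level Ops.kl J M (⊥ : A) = 0 := by
      rw [p.level_eq_zero, h.kl_bot]
      exact p.isMaximal.toIsProper.top_notMem
    refine ⟨fun x => ⟨level Ops.kl J M x⟩, ?_, fun hf => ?_⟩
    · exact
        { map_inf := fun x y => congrArg ULift.up (p.level_inf h.toIsKleene x y)
          map_sup := fun x y => congrArg ULift.up (p.level_sup h.toIsKleene x y)
          map_kl := fun x => congrArg ULift.up (p.level_kl h.toIsKleene x)
          map_br := fun x => (congrArg ULift.up (p.level_br h x)).trans (apply_ite ULift.up _ _ _)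
          map_bot := congrArg ULift.up hbot
          map_top := congrArg ULift.up (level_eq_four p.isMaximal.toIsProper.top_notMem) }
    · have hf' : level Ops.kl J M a = level Ops.kl J M b := congrArg ULift.down hf
      rcases hsep with ⟨ha, hb⟩ | ⟨hb, ha⟩
      · exact p.level_ne ha hb hf'
      · apply p.level_ne hb ha
        rw [p.level_kl h.toIsKleene, p.level_kl h.toIsKleene, hf']
  by_cases hle : a ≤ b
  · obtain ⟨f, hf, hne⟩ := main b a fun hba => hab (le_antisymm hle hba)
    exact ⟨f, hf, hne.symm⟩
  · exact main a b hle

end Identities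

/-! ### Varieties and models of identities -/

theorem IsHom.eval {A B : Type u} [Ops A] [Ops B] {f : A → B} (hf : IsHom f) (v : ℕ → A)
    (t : Term) : t.eval (fun n => f (v n)) = f (t.eval v) := by
  induction t with
  | var n => rfl
  | inf s t hs ht => simp only [Term.eval, hs, ht, hf.map_inf]
  | sup s t hs ht => simp only [Term.eval, hs, ht, hf.map_sup]
  | kl t ht => simp only [Term.eval, ht, hf.map_kl]
  | br t ht => simp only [Term.eval, ht, hf.map_br]
  | bot => exact hf.map_bot.symm
  | top => exact hf.map_top.symm

theorem isHom_proj {I : Type u} (A : I → Alg.{u}) (i : I) :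
    IsHom (fun a : prod A => (a : ∀ i, A i) i) :=
  ⟨fun _ _ => rfl, fun _ _ => rfl, fun _ => rfl, fun _ => rfl, rfl, rfl⟩

theorem isVariety_mod (E : Set (Term × Term)) : IsVariety (Mod.{u} E) where
  image A B f hf hsurj hA e he v := by
    obtain ⟨g, hg⟩ := hsurj.hasRightInverse
    have hv : v = fun n => f (g (v n)) := funext fun n => (hg (v n)).symm
    rw [hv, hf.eval, hf.eval, hA e he]
  sub A B f hf hinj hB e he v := by
    apply hinj
    rw [← hf.eval, ← hf.eval, hB e he]
  prod I A hA e he v := by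
    funext i
    exact ((isHom_proj A i).eval v e.1).symm.trans
      ((hA i e he _).trans ((isHom_proj A i).eval v e.2))

theorem mem_V_of_separating {A B : Alg.{u}}
    (h : ∀ a b : A, a ≠ b → ∃ f : A → B, IsHom f ∧ f a ≠ f b) : A ∈ V {B} := by
  intro W hW hBW
  choose f hf hne using h
  refine hW.sub A (prod fun _ : {q : A × A // q.1 ≠ q.2} => B)
    (fun x q => f q.1.1 q.1.2 q.2 x) ?_ ?_ (hW.prod _ _ fun _ => hBW rfl)
  · exact
      { map_inf := fun a b => funext fun q => (hf _ _ q.2).map_inf a b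
        map_sup := fun a b => funext fun q => (hf _ _ q.2).map_sup a b
        map_kl := fun a => funext fun q => (hf _ _ q.2).map_kl a
        map_br := fun a => funext fun q => (hf _ _ q.2).map_br a
        map_bot := funext fun q => (hf _ _ q.2).map_bot
        map_top := funext fun q => (hf _ _ q.2).map_top }
  · intro a b hab
    by_contra hne'
    exact hne a b hne' (congrFun hab ⟨(a, b), hne'⟩)

/-! ### The five-element chain -/

theorem isAntiortholattice_D_five : IsAntiortholattice (D.{u} 5) where
  inf_comm := fun ⟨a⟩ ⟨b⟩ => congrArg ULift.up (min_comm a b)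
  sup_comm := fun ⟨a⟩ ⟨b⟩ => congrArg ULift.up (max_comm a b)
  inf_assoc := fun ⟨a⟩ ⟨b⟩ ⟨c⟩ => congrArg ULift.up (min_assoc a b c)
  sup_assoc := fun ⟨a⟩ ⟨b⟩ ⟨c⟩ => congrArg ULift.up (max_assoc a b c)
  inf_sup_self := fun ⟨a⟩ ⟨b⟩ => congrArg ULift.up (inf_sup_self (a := a) (b := b))
  sup_inf_self := fun ⟨a⟩ ⟨b⟩ => congrArg ULift.up (sup_inf_self (a := a) (b := b))
  bot_le := by rintro ⟨a⟩; fin_cases a <;> rfl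
  le_top := by rintro ⟨a⟩; fin_cases a <;> rfl
  kl_kl := fun ⟨a⟩ => congrArg ULift.up (Fin.rev_rev a)
  kl_anti := by
    rintro ⟨a⟩ ⟨b⟩ h
    have key : ∀ a b : Fin 5, min a b = a → min (Fin.rev b) (Fin.rev a) = Fin.rev b := by decide
    exact congrArg ULift.up (key a b (congrArg ULift.down h))
  kleene := by
    rintro ⟨a⟩ ⟨b⟩
    have key : ∀ a b : Fin 5, min (min a (Fin.rev a)) (max b (Fin.rev b)) = min a (Fin.rev a) := by
      decide
    exact congrArg ULift.up (key a b)
  inf_br := by rintro ⟨a⟩; fin_cases a <;> rfl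
  le_br_br := by rintro ⟨a⟩; fin_cases a <;> rfl
  br_anti := by
    rintro ⟨a⟩ ⟨b⟩ h
    have h' : min a b = a := congrArg ULift.down h
    fin_cases a <;> fin_cases b <;> first | rfl | exact absurd h' (by decide)
  kl_br := by rintro ⟨a⟩; fin_cases a <;> rfl
  star := by rintro ⟨a⟩; fin_cases a <;> rfl
  paraorthomodular := by
    rintro ⟨a⟩ ⟨b⟩ hab h
    have key : ∀ a b : Fin 5, min a b = a → min (Fin.rev a) b = 0 → a = b := by decide
    exact congrArg ULift.up (key a b (congrArg ULift.down hab) (congrArg ULift.down h))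
  kleeneSharp_eq := by
    have key : ∀ a : Fin 5, min a (Fin.rev a) = 0 ↔ a = 0 ∨ a = Fin.rev 0 := by decide
    ext ⟨a⟩
    constructor
    · intro h
      exact ((key a).1 (congrArg ULift.down h)).imp (congrArg ULift.up) (congrArg ULift.up)
    · intro h
      exact congrArg ULift.up ((key a).2 (h.imp (congrArg ULift.down) (congrArg ULift.down)))

theorem D_five_mem : D.{u} 5 ∈ Mod (Identities AOL.{u} ∪ {DIST, SDM}) := by
  rintro e (he | rfl | rfl) v
  · exact he _ isAntiortholattice_D_five v
  · exact congrArg ULift.up (inf_sup_left (v 0).down (v 1).down (v 2).down)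
  · have key : ∀ a b : D.{u} 5, Ops.br (a ⊓ b) = Ops.br a ⊔ Ops.br b := by
      rintro ⟨a⟩ ⟨b⟩
      fin_cases a <;> fin_cases b <;> rfl
    exact key (v 0) (v 1)

end PBZ

theorem corollary3p12 :
    (PBZ.Mod (PBZ.Identities PBZ.AOL.{u} ∪ {PBZ.DIST, PBZ.SDM}) : Set PBZ.Alg.{u}) =
      PBZ.V {PBZ.D.{u} 5} := by
  apply Set.Subset.antisymm
  · exact fun A hA => PBZ.mem_V_of_separating fun a b hab => PBZ.exists_isHom_ne hA hab
  · exact fun A hA => hA _ (PBZ.isVariety_mod _) (Set.singleton_subset_iff.2 PBZ.D_five_mem)
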